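/- Let $\mathbf{Cstar}$ be the category of unital complex C*-algebras (the zero algebra included) and unital $*$-homomorphisms, and let $\mathbf{cCstar}\subseteq\mathbf{Cstar}$ be the full subcategory of commutative ones. Let $\mathbf{Topos}$ be the category whose objects are (elementary) toposes and whose morphisms are isomorphism classes of geometric morphisms, and let $\mathrm{Sh}\colon\mathbf{Loc}\to\mathbf{Topos}$ be the functor taking a locale to its topos of sheaves of sets. For a commutative C*-algebra $A$, let $\mathrm{Spec}(A)$ be its Gelfand spectrum, i.e. the locale of open sets of the space of characters of $A$ with the weak-$*$ topology; this is a functor $\mathrm{Spec}\colon\mathbf{cCstar}^{\mathrm{op}}\to\mathbf{Loc}$. Let $G\colon\mathbf{Cstar}^{\mathrm{op}}\to\mathbf{Topos}$ be any functor that assigns to each commutative C*-algebra its Gelfand spectrum, in the sense that the restriction of $G$ to $\mathbf{cCstar}^{\mathrm{op}}$ is naturally isomorphic to $\mathrm{Sh}\circ\mathrm{Spec}$. Then for every $n\ge 3$, $G$ trivializes on the C*-algebra $M_n(\mathbb{C})$ (hence on every C*-algebra that is $*$-isomorphic to it): $G(M_n(\mathbb{C}))$ is an initial object of $\mathbf{Topos}$,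 that is, a degenerate topos (one equivalent to the terminal category). -/

import Mathlib

open CategoryTheory CategoryTheory.Limits Opposite

universe u

noncomputable section

/-! ### Unital C*-algebras -/

/-- The objects of the category of unital complex C*-algebras (the zero algebra is allowed). -/
structure CStarAlg where
  /-- The underlying type. -/
  carrier : Type u
  [str : CStarAlgebra carrier]

namespace CStarAlg

instance : CoeSort CStarAlg.{u} (Type u) := ⟨CStarAlg.carrier⟩

instance (A : CStarAlg.{u}) : CStarAlgebra A := A.str

/-- A morphism of C*-algebras: a unital *-homomorphism. -/
@[ext]
structure Hom (A B : CStarAlg.{u}) where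
  /-- The underlying unital *-homomorphism. -/
  hom : A →⋆ₐ[ℂ] B

instance : Category CStarAlg.{u} where
  Hom A B := Hom A B
  id A := ⟨StarAlgHom.id ℂ A⟩
  comp f g := ⟨g.hom.comp f.hom⟩

/-- Commutativity, as a property of C*-algebras. The corresponding full subcategory is the
category of commutative C*-algebras. -/
def commutative : ObjectProperty CStarAlg.{u} :=
  fun A => ∀ a b : A, a * b = b * a

/-- The Gelfand spectrum of commutative C*-algebras as a functor to locales: the locale of opens
of the space of characters (with the weak-* topology). A *-homomorphism acts by precomposition. -/
def gelfandSpectrum : (commutative.{u}.FullSubcategory)ᵒᵖ ⥤ Locale.{u} where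
  obj A := topToLocale.obj (TopCat.of (WeakDual.characterSpace ℂ A.unop.obj))
  map f := topToLocale.map
    (TopCat.ofHom (WeakDual.CharacterSpace.compContinuousMap f.unop.hom.hom))
  map_id _ := rfl
  map_comp _ _ := rfl

end CStarAlg

/-! ### Toposes -/

/-- A category is an (elementary) topos if it has finite limits, is cartesian closed, and has a
subobject classifier. -/
class IsTopos (E : Type*) [Category* E] : Prop where
  hasFiniteLimits : HasFiniteLimits E
  cartesianClosed : ∀ X : E, (prod.functor.obj X).IsLeftAdjoint
  hasSubobjectClassifier : HasSubobjectClassifier E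

/-- The objects of the category of toposes: toposes whose objects form a (possibly large) class
and whose morphisms between any two objects form a set. -/
structure Topos where
  /-- The type of objects. -/
  carrier : Type (u + 1)
  [cat : Category.{u} carrier]
  [isTopos : IsTopos carrier]

/-- A geometric morphism `E → F` between categories with finite limits: an adjunction
`inverse ⊣ direct` with `direct : E ⥤ F` and `inverse` preserving finite limits. -/
structure GeometricMorphism (E F : Type*) [Category* E] [Category* F] where
  /-- The direct image functor. -/
  direct : E ⥤ F
  /-- The inverse image functor. -/
  inverse : F ⥤ E
  /-- The inverse image is left adjoint to the direct image. -/
  adj : inverse ⊣ direct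
  lex : PreservesFiniteLimits inverse

namespace GeometricMorphism

/-- The identity geometric morphism. -/
def id (E : Type*) [Category* E] : GeometricMorphism E E where
  direct := 𝟭 E
  inverse := 𝟭 E
  adj := Adjunction.id
  lex := inferInstance

/-- The composite of two geometric morphisms. -/
def comp {E F H : Type*} [Category* E] [Category* F] [Category* H]
    (f : GeometricMorphism E F) (g : GeometricMorphism F H) : GeometricMorphism E H where
  direct := f.direct ⋙ g.direct
  inverse := g.inverse ⋙ f.inverse
  adj := g.adj.comp f.adj
  lex := by
    have := f.lex
    have := g.lex
    exact comp_preservesFiniteLimits _ _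

/-- Two parallel geometric morphisms are isomorphic if their inverse image functors are naturally
isomorphic (equivalently, if their direct image functors are). -/
def setoid (E F : Type*) [Category* E] [Category* F] : Setoid (GeometricMorphism E F) where
  r f g := Nonempty (f.inverse ≅ g.inverse)
  iseqv :=
    { refl := fun f => ⟨Iso.refl f.inverse⟩
      symm := fun ⟨e⟩ => ⟨e.symm⟩
      trans := fun ⟨e⟩ ⟨e'⟩ => ⟨e ≪≫ e'⟩ }

end GeometricMorphism

namespace Topos

instance : CoeSort Topos.{u} (Type (u + 1)) := ⟨Topos.carrier⟩

instance (E : Topos.{u}) : Category.{u} E := E.cat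

instance (E : Topos.{u}) : IsTopos E := E.isTopos

/-- The category of toposes. Its morphisms are isomorphism classes of geometric morphisms. -/
instance : Category Topos.{u} where
  Hom E F := Quotient (GeometricMorphism.setoid E F)
  id E := Quotient.mk _ (GeometricMorphism.id E)
  comp {E F H} f g := Quotient.map₂ (sa := GeometricMorphism.setoid E F)
    (sb := GeometricMorphism.setoid F H) (sc := GeometricMorphism.setoid E H)
    GeometricMorphism.comp (fun _ _ ⟨e⟩ _ _ ⟨e'⟩ => ⟨NatIso.hcomp e' e⟩) f g
  id_comp f := by
    induction f using Quotient.inductionOn with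
    | h f => exact Quotient.sound ⟨f.inverse.rightUnitor⟩
  comp_id f := by
    induction f using Quotient.inductionOn with
    | h f => exact Quotient.sound ⟨f.inverse.leftUnitor⟩
  assoc f g h := by
    induction f using Quotient.inductionOn with
    | h f =>
      induction g using Quotient.inductionOn with
      | h g =>
        induction h using Quotient.inductionOn with
        | h h =>
          exact Quotient.sound ⟨(Functor.associator h.inverse g.inverse f.inverse).symm⟩

end Topos

/-- In a cartesian closed monoidal category, taking products with a fixed object is a left
adjoint. -/
theorem isLeftAdjoint_prodFunctor {E : Type*} [Category* E] [CartesianMonoidalCategory E]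
    [MonoidalClosed E] [HasBinaryProducts E] (X : E) : (prod.functor.obj X).IsLeftAdjoint := by
  have h : (MonoidalCategory.tensorLeft X).IsLeftAdjoint := inferInstance
  refine @Functor.isLeftAdjoint_of_iso _ _ _ _ _ _ ?_ h
  let e (Y : E) : MonoidalCategory.tensorObj X Y ≅ prod X Y :=
    (CartesianMonoidalCategory.tensorProductIsBinaryProduct X Y).conePointUniqueUpToIso
      (limit.isLimit (pair X Y))
  have h₁ (Y : E) : (e Y).hom ≫ prod.fst = SemiCartesianMonoidalCategory.fst X Y :=
    IsLimit.conePointUniqueUpToIso_hom_comp _ _ (Discrete.mk WalkingPair.left)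
  have h₂ (Y : E) : (e Y).hom ≫ prod.snd = SemiCartesianMonoidalCategory.snd X Y :=
    IsLimit.conePointUniqueUpToIso_hom_comp _ _ (Discrete.mk WalkingPair.right)
  have hr₂ (Y W : E) (g : Y ⟶ W) :
      (e Y).hom ≫ prod.snd ≫ g = SemiCartesianMonoidalCategory.snd X Y ≫ g := by
    rw [← Category.assoc, h₂]
  clear_value e
  have h₃ (Y Z : E) (f : Y ⟶ Z) :
      MonoidalCategoryStruct.whiskerLeft X f ≫ (e Z).hom = (e Y).hom ≫ prod.map (𝟙 X) f := by
    apply Limits.prod.hom_ext <;> simp [h₁, h₂, hr₂]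
  exact NatIso.ofComponents e (fun {Y Z} f => h₃ Y Z f)

/-- Sheaves of sets on a small site form a topos. -/
instance {C : Type u} [SmallCategory C] (J : GrothendieckTopology C) :
    IsTopos (Sheaf J (Type u)) where
  hasFiniteLimits := inferInstance
  cartesianClosed := by
    have h : MonoidalClosed (Sheaf J (Type u)) := inferInstance
    exact @isLeftAdjoint_prodFunctor (Sheaf J (Type u)) _ _ h _
  hasSubobjectClassifier := inferInstance

/-! ### Sheaves on a locale -/

namespace Locale

/-- The Grothendieck topology on a frame, viewed as a poset category: a sieve on `U` covers if `U`
is the join of the elements of the sieve. -/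
def topology (L : Type*) [Order.Frame L] : GrothendieckTopology L where
  sieves U := {S | sSup {V | ∃ f : V ⟶ U, S f} = U}
  top_mem' U := le_antisymm (sSup_le fun _ ⟨f, _⟩ => leOfHom f) (le_sSup ⟨𝟙 U, trivial⟩)
  pullback_stable' U V S g hS := by
    refine le_antisymm (sSup_le fun _ ⟨f, _⟩ => leOfHom f) ?_
    have h : V = V ⊓ sSup {W | ∃ f : W ⟶ U, S f} := by
      rw [show sSup {W | ∃ f : W ⟶ U, S f} = U from hS, inf_eq_left.2 (leOfHom g)]
    refine h.le.trans ?_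
    rw [inf_sSup_eq]
    refine iSup₂_le fun W ⟨f, hf⟩ => le_sSup ⟨homOfLE inf_le_left, ?_⟩
    exact S.downward_closed hf (homOfLE inf_le_right)
  transitive' U S hS R hR := by
    refine le_antisymm (sSup_le fun _ ⟨f, _⟩ => leOfHom f) ?_
    refine (show sSup {V | ∃ f : V ⟶ U, S f} = U from hS).ge.trans ?_
    refine sSup_le fun V ⟨f, hf⟩ => ?_
    refine (show sSup {W | ∃ g : W ⟶ V, R.pullback f g} = V from hR hf).ge.trans ?_
    exact sSup_le fun W ⟨g, hg⟩ => le_sSup ⟨g ≫ f, hg⟩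

/-- The category of sheaves of sets on a locale. -/
abbrev Sh (L : Locale.{u}) : Type (u + 1) := Sheaf (topology L) (Type u)

variable {L M : Type u} [Order.Frame L] [Order.Frame M]

/-- A frame homomorphism as a functor between poset categories. -/
def frameFunctor (φ : FrameHom M L) : M ⥤ L :=
  (OrderHomClass.mono φ : Monotone φ).functor

instance (φ : FrameHom M L) : RepresentablyFlat (frameFunctor φ) where
  cofiltered X :=
    { cone_objs := fun A B =>
        ⟨StructuredArrow.mk (Y := A.right ⊓ B.right)
            (homOfLE ((le_inf (leOfHom A.hom) (leOfHom B.hom)).trans_eq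
              (map_inf φ A.right B.right).symm)),
          StructuredArrow.homMk (homOfLE inf_le_left) (Subsingleton.elim _ _),
          StructuredArrow.homMk (homOfLE inf_le_right) (Subsingleton.elim _ _), trivial⟩
      cone_maps := fun A B f g => ⟨A, 𝟙 A, by ext; exact Subsingleton.elim _ _⟩
      nonempty := ⟨StructuredArrow.mk (Y := ⊤) (homOfLE (le_top.trans_eq (map_top φ).symm))⟩ }

instance (φ : FrameHom M L) : (frameFunctor φ).IsContinuous (topology M) (topology L) := by
  refine Functor.isContinuous_of_coverPreserving (compatiblePreservingOfFlat _ _) ⟨?_⟩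
  intro U S hS
  refine le_antisymm (sSup_le fun _ ⟨f, _⟩ => leOfHom f) ?_
  have h : φ (sSup {V | ∃ f : V ⟶ U, S f}) = φ U := congrArg φ hS
  rw [map_sSup] at h
  refine h.ge.trans (sSup_le ?_)
  rintro _ ⟨V, ⟨f, hf⟩, rfl⟩
  exact le_sSup ⟨(frameFunctor φ).map f, Sieve.image_mem_functorPushforward _ _ hf⟩

/-- The geometric morphism between sheaf toposes induced by a frame homomorphism `φ`. Its direct
image sends a sheaf `X` to `U ↦ X (φ U)`. -/
def shMap (φ : FrameHom M L) :
    GeometricMorphism (Sheaf (topology L) (Type u)) (Sheaf (topology M) (Type u)) where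
  direct := (frameFunctor φ).sheafPushforwardContinuous (Type u) (topology M) (topology L)
  inverse := (frameFunctor φ).sheafPullback (Type u) (topology M) (topology L)
  adj := (frameFunctor φ).sheafAdjunctionContinuous (Type u) (topology M) (topology L)
  lex := by
    apply Functor.SmallCategories.instPreservesFiniteLimitsSheafSheafPullbackOfRepresentablyFlat

/-- Sheaves on locales, as a functor from locales to toposes. -/
def shFunctor : Locale.{u} ⥤ Topos.{u} where
  obj L := ⟨L.Sh⟩
  map f := Quotient.mk _ (shMap f.unop.hom)
  map_id L := Quotient.sound
    ⟨(shMap (FrameHom.id L)).adj.leftAdjointUniq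
      (Adjunction.id.ofNatIsoRight (Iso.refl _))⟩
  map_comp f g := Quotient.sound
    ⟨(shMap (f.unop.hom.comp g.unop.hom)).adj.leftAdjointUniq
      (((shMap g.unop.hom).adj.comp (shMap f.unop.hom).adj).ofNatIsoRight (Iso.refl _))⟩

end Locale

end

/-! The argument is the Kochen-Specker theorem run inside the topos `G(M)`. A projection `p` of `M`
is a *-homomorphism `ℂ² → M`; the induced geometric morphism to sheaves on the two-point spectrum
pulls one of the points back to an object `supportProj p`. If `p` belongs to a complete orthogonal
family, then `ℂ² → M` factors through the algebra `ℂ^ι → M` of that family. Functoriality of `G` and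
naturality of the comparison therefore force the supports of the family to be disjoint
(`isInitial_of_hom_supportProj`) and jointly covering (`isInitial_of_forall_supportProj`), and the
support of `p` does not depend on the family.

Thus `G(M)` carries an internal colouring of projections with exactly one choice per orthogonal
basis. As `G(M)` may have no points, the colouring is brought down to sets by compactness: call a
finite set of vectors inconsistent if every object mapping to all their supports is initial. If some
object were not initial, Zorn's lemma (`exists_consistent`) would give a consistent set meeting
every orthogonal frame. That set would be a colouring, which `not_isColoring` excludes. So every
object of `G(M)` is initial, and such a topos is degenerate and initial. -/

noncomputable section

/-! ### Toposes with few morphisms -/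

namespace IsTopos

variable {E : Type*} [Category* E] [IsTopos E]

/-- Initial objects of a topos are strict. -/
theorem isInitial_of_hom {I W : E} (hI : IsInitial I) (f : W ⟶ I) : Nonempty (IsInitial W) := by
  have := IsTopos.hasFiniteLimits (E := E)
  have := IsTopos.cartesianClosed W
  have hP : IsInitial (W ⨯ I) := IsInitial.isInitialObj (prod.functor.obj W) I hI
  -- `W` is a retract of the initial object `W ⨯ I`, through the graph of `f` and the first
  -- projection.
  exact ⟨IsInitial.ofUniqueHom (fun Y => prod.lift (𝟙 W) f ≫ hP.to Y) fun Y m => by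
    rw [← hP.hom_ext (prod.fst ≫ m) (hP.to Y), prod.lift_fst_assoc, Category.id_comp]⟩

/-- A nonempty category whose objects are all initial is equivalent to the terminal category. -/
theorem nonempty_equivalence_punit {C : Type*} [Category* C] (X : C)
    (h : ∀ W : C, Nonempty (IsInitial W)) : Nonempty (C ≌ Discrete PUnit.{u + 1}) := by
  have hs (A B : C) : Unique (A ⟶ B) := ⟨⟨(h A).some.to B⟩, fun _ => (h A).some.hom_ext _ _⟩
  exact ⟨{
    functor := Functor.star C
    inverse := Functor.fromPUnit X
    unitIso := NatIso.ofComponents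
      (fun W => (h W).some.uniqueUpToIso (h X).some) fun _ => (h _).some.hom_ext _ _
    counitIso := Functor.punitExt _ _
    functor_unitIso_comp := fun _ => Subsingleton.elim _ _ }⟩

end IsTopos

namespace Topos

/-- A topos whose objects are all initial is an initial object of the category of toposes. -/
theorem nonempty_isInitial (E : Topos.{u}) (h : ∀ W : E, Nonempty (IsInitial W)) :
    Nonempty (IsInitial E) := by
  have hE := IsTopos.hasFiniteLimits (E := E)
  have ht (W : E) : IsTerminal W :=
    IsTerminal.ofUniqueHom (fun Y => (h Y).some.to W) fun Y _ => (h Y).some.hom_ext _ _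
  -- Morphisms of toposes are compared through their inverse images, which here land in `E`; this
  -- gives uniqueness.
  have hi {F : Topos.{u}} (a b : F ⥤ E) : a ≅ b := NatIso.ofComponents
      (fun W => (h _).some.uniqueUpToIso (h _).some) fun _ => (h _).some.hom_ext _ _
  have key (F : Topos.{u}) : Nonempty (Unique (E ⟶ F)) := by
    have hF := IsTopos.hasFiniteLimits (E := F)
    let g : GeometricMorphism E F :=
      { direct := (Functor.const E).obj (⊤_ F)
        inverse := (Functor.const F).obj (⊤_ E)
        adj := Adjunction.mkOfHomEquiv
          { homEquiv := fun A B =>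
              { toFun := fun _ => terminal.from A
                invFun := fun _ => (h (⊤_ E)).some.to B
                left_inv := fun _ => (h (⊤_ E)).some.hom_ext _ _
                right_inv := fun _ => terminalIsTerminal.hom_ext _ _ }
            homEquiv_naturality_left_symm := fun _ _ => (h (⊤_ E)).some.hom_ext _ _
            homEquiv_naturality_right := fun _ _ => terminalIsTerminal.hom_ext _ _ }
        lex := ⟨fun J _ _ => ⟨fun {K} => ⟨fun {c} _ =>
          ⟨{lift := fun s => (ht _).from _
            fac := fun _ _ => (ht _).hom_ext _ _
            uniq := fun _ _ _ => (ht _).hom_ext _ _ }⟩⟩⟩⟩ }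
    refine ⟨⟨⟨Quotient.mk _ g⟩, fun f => ?_⟩⟩
    induction f using Quotient.inductionOn with
    | h f => exact Quotient.sound ⟨hi _ _⟩
  have (F : Topos.{u}) : Unique (E ⟶ F) := (key F).some
  exact ⟨IsInitial.ofUnique E⟩

end Topos

/-! ### Representable sheaves on a locale -/

namespace Locale

/-- This lets every element of the frame be treated as a sheaf, through `(topology L).yoneda`. -/
instance {L : Type u} [Order.Frame L] : (topology L).Subcanonical := by
  refine .of_isSheaf_yoneda_obj _ fun X U S hS x hx => ?_
  have hU : U ≤ X := by
    refine (show sSup {V | ∃ f : V ⟶ U, S f} = U from hS).ge.trans (sSup_le ?_)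
    rintro V ⟨f, hf⟩
    exact leOfHom (x f hf)
  exact ⟨homOfLE hU, fun V _ _ => Subsingleton.elim (α := (V ⟶ X)) _ _,
    fun _ _ => Subsingleton.elim (α := (U ⟶ X)) _ _⟩

variable {L : Type u} [Order.Frame L]

theorem subsingleton_hom_yoneda (F : Sheaf (topology L) (Type u)) (V : L) :
    Subsingleton (F ⟶ (topology L).yoneda.obj V) :=
  ⟨fun f g => by
    apply Sheaf.hom_ext
    ext U x
    exact Subsingleton.elim (α := (unop U ⟶ V)) _ _⟩

/-- A left adjoint functor out of the sheaves on a locale that sends the elements of a cover of `U`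
to initial objects sends `U` to an initial object. -/
theorem isInitial_obj_yoneda {E : Type*} [Category.{u} E] {H : Sheaf (topology L) (Type u) ⥤ E}
    {R : E ⥤ Sheaf (topology L) (Type u)} (adj : H ⊣ R) {U : L} (S : Sieve U)
    (hS : S ∈ topology L U)
    (h : ∀ ⦃V : L⦄ (f : V ⟶ U), S f → Nonempty (IsInitial (H.obj ((topology L).yoneda.obj V)))) :
    Nonempty (IsInitial (H.obj ((topology L).yoneda.obj U))) := by
  -- By adjunction and Yoneda, maps from the image of `V` to `X` are sections of the sheaf `R.obj X`
  -- over `V`. Sections over the cover are unique, hence compatible, and glue to a unique section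
  -- over `U`.
  let e (V : L) (X : E) :
      (H.obj ((topology L).yoneda.obj V) ⟶ X) ≃ (R.obj X).obj.obj (op V) :=
    (adj.homEquiv _ _).trans ((topology L).yonedaEquiv)
  have hsub {V : L} (f : V ⟶ U) (hf : S f) (X : E) (a b : (R.obj X).obj.obj (op V)) : a = b :=
    (e V X).symm.injective ((h f hf).some.hom_ext _ _)
  have hsheaf (X : E) := ((isSheaf_iff_isSheaf_of_type _ _).1 (R.obj X).property) S hS
  have key (X : E) : Nonempty (Unique (H.obj ((topology L).yoneda.obj U) ⟶ X)) := by
    obtain ⟨t, -, ht⟩ := hsheaf X (fun V f hf => e V X ((h f hf).some.to X))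
      (fun V₁ V₂ Z g₁ g₂ f₁ f₂ h₁ h₂ _ =>
        hsub (g₁ ≫ f₁) (S.downward_closed h₁ g₁) X _ _)
    refine ⟨⟨⟨(e U X).symm t⟩, fun m => ?_⟩⟩
    refine (Equiv.eq_symm_apply (e U X)).2 ?_
    exact ht _ fun V f hf => hsub f hf X _ _
  have (X : E) : Unique (H.obj ((topology L).yoneda.obj U) ⟶ X) := (key X).some
  exact ⟨IsInitial.ofUnique _⟩

/-- A left adjoint functor sends the bottom element of the locale to an initial object. -/
theorem isInitial_obj_yoneda_bot {E : Type*} [Category.{u} E]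
    {H : Sheaf (topology L) (Type u) ⥤ E} {R : E ⥤ Sheaf (topology L) (Type u)} (adj : H ⊣ R) :
    Nonempty (IsInitial (H.obj ((topology L).yoneda.obj ⊥))) :=
  isInitial_obj_yoneda adj ⊥ (le_bot_iff.1 (sSup_le fun _ ⟨_, hf⟩ => hf.elim))
    fun _ _ hf => hf.elim

/-- Inverse images of open subsets respect disjointness. -/
theorem isInitial_of_inf_eq_bot {E : Type*} [Category.{u} E] [IsTopos E]
    (g : GeometricMorphism E (Sheaf (topology L) (Type u))) {S T : L} (hST : S ⊓ T = ⊥) {W : E}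
    (a : W ⟶ g.inverse.obj ((topology L).yoneda.obj S))
    (b : W ⟶ g.inverse.obj ((topology L).yoneda.obj T)) : Nonempty (IsInitial W) := by
  obtain ⟨hI⟩ := isInitial_obj_yoneda_bot g.adj
  have := g.lex
  let K := (topology L).yoneda.obj S ⨯ (topology L).yoneda.obj T
  -- The inverse image preserves the product, so `W` maps to the image of `⊥`, which is initial, and
  -- initial objects are strict.
  let p : K ⟶ (topology L).yoneda.obj ⊥ :=
    ⟨{app := fun V => ↾fun k => homOfLE (hST ▸ le_inf
          (leOfHom ((prod.fst : K ⟶ (topology L).yoneda.obj S).hom.app V k))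
          (leOfHom ((prod.snd : K ⟶ (topology L).yoneda.obj T).hom.app V k)))
      naturality := fun V V' f => by ext; exact Subsingleton.elim (α := (unop V' ⟶ (⊥ : L))) _ _ }⟩
  have hl := mapIsLimitOfPreservesOfIsLimit g.inverse _ _ (prodIsProd
    ((topology L).yoneda.obj S) ((topology L).yoneda.obj T))
  exact IsTopos.isInitial_of_hom hI (hl.lift (BinaryFan.mk a b) ≫ g.inverse.map p)

/-- Inverse images of open subsets respect covers. -/
theorem isInitial_of_iSup_eq_top {E : Type*} [Category.{u} E] [IsTopos E]
    (g : GeometricMorphism E (Sheaf (topology L) (Type u))) {ι : Type*} {S : ι → L}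
    (hS : ⨆ i, S i = ⊤) {W : E}
    (h : ∀ (i : ι) (W' : E), (W' ⟶ W) → (W' ⟶ g.inverse.obj ((topology L).yoneda.obj (S i))) →
      Nonempty (IsInitial W')) : Nonempty (IsInitial W) := by
  have := IsTopos.hasFiniteLimits (E := E)
  have := IsTopos.cartesianClosed W
  have := g.lex
  -- The functor `W ⨯ g.inverse.obj _` is again a left adjoint, so the gluing lemma shows that its
  -- value at `⊤` is initial. Since `g.inverse` preserves the terminal object, `W` maps to that
  -- value.
  let adj := g.adj.comp (Adjunction.ofIsLeftAdjoint (prod.functor.obj W))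
  let T : Sieve (⊤ : L) :=
    { arrows := fun V _ => ∃ i, V ≤ S i
      downward_closed := fun ⟨i, hi⟩ k => ⟨i, (leOfHom k).trans hi⟩ }
  obtain ⟨hW⟩ := isInitial_obj_yoneda adj T
    (top_le_iff.1 (hS.ge.trans (iSup_le fun i => le_sSup ⟨homOfLE le_top, i, le_rfl⟩)))
    (fun V f ⟨i, hi⟩ => h i (W ⨯ g.inverse.obj ((topology L).yoneda.obj V)) prod.fst
      (prod.snd ≫ g.inverse.map ((topology L).yoneda.map (homOfLE hi))))
  have hT : IsTerminal ((topology L).yoneda.obj (⊤ : L)) :=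
    IsTerminal.ofUniqueHom (fun F => ⟨{
      app := fun V => ↾fun k => homOfLE le_top
      naturality := fun V V' f => by
        ext; exact Subsingleton.elim (α := (unop V' ⟶ (⊤ : L))) _ _ }⟩)
      fun F m => (subsingleton_hom_yoneda F _).elim _ _
  exact IsTopos.isInitial_of_hom hW
    (prod.lift (𝟙 W) ((IsTerminal.isTerminalObj g.inverse _ hT).from W))

variable {M : Type u} [Order.Frame M]

/-- The inverse image extends `φ` along Yoneda. Here and in the next lemma bare maps suffice:
supports are later used only through the existence of maps into them. -/
theorem nonempty_hom_shMap_inverse (φ : FrameHom M L) (V : M) :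
    Nonempty ((topology L).yoneda.obj (φ V) ⟶
      (shMap φ).inverse.obj ((topology M).yoneda.obj V)) := by
  let x := (topology M).yonedaEquiv ((shMap φ).adj.unit.app ((topology M).yoneda.obj V))
  exact ⟨(topology L).yonedaEquiv.symm x⟩

theorem nonempty_shMap_inverse_hom (φ : FrameHom M L) (V : M) :
    Nonempty ((shMap φ).inverse.obj ((topology M).yoneda.obj V) ⟶
      (topology L).yoneda.obj (φ V)) := by
  let x : ((shMap φ).direct.obj ((topology L).yoneda.obj (φ V))).obj.obj (op V) := 𝟙 (φ V)
  exact ⟨((shMap φ).adj.homEquiv _ _).symm ((topology M).yonedaEquiv.symm x)⟩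

end Locale

/-! ### The Kochen-Specker theorem -/

open scoped Matrix

namespace KochenSpecker

/-- An orthogonal basis of nonzero integer vectors. -/
def IsOrthogonalFrame {ι : Type*} [Fintype ι] (v : ι → ι → ℤ) : Prop :=
  (∀ i, v i ≠ 0) ∧ ∀ i j, i ≠ j → v i ⬝ᵥ v j = 0

/-- A colouring of vectors selects exactly one element of every orthogonal basis. -/
def IsColoring {ι : Type*} [Fintype ι] (c : (ι → ℤ) → Prop) : Prop :=
  ∀ v : ι → ι → ℤ, IsOrthogonalFrame v → ∃! i, c (v i)

section Three

variable {c : (Fin 3 → ℤ) → Prop}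

theorem IsColoring.exists_of_triple (hc : IsColoring c) (a b d : Fin 3 → ℤ)
    (h : (a ≠ 0 ∧ b ≠ 0 ∧ d ≠ 0) ∧ a ⬝ᵥ b = 0 ∧ a ⬝ᵥ d = 0 ∧ b ⬝ᵥ d = 0) :
    ∃! i, c (![a, b, d] i) := by
  obtain ⟨⟨ha, hb, hd⟩, hab, had, hbd⟩ := h
  refine hc _ ⟨fun i => ?_, fun i j hij => ?_⟩
  · fin_cases i <;> assumption
  · fin_cases i <;> fin_cases j <;>
      first | exact absurd rfl hij | assumption | (rw [dotProduct_comm]; assumption)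

theorem IsColoring.third (hc : IsColoring c) (a b d : Fin 3 → ℤ)
    (h : (a ≠ 0 ∧ b ≠ 0 ∧ d ≠ 0) ∧ a ⬝ᵥ b = 0 ∧ a ⬝ᵥ d = 0 ∧ b ⬝ᵥ d = 0)
    (ha : ¬c a) (hb : ¬c b) : c d := by
  obtain ⟨i, hi, -⟩ := hc.exists_of_triple a b d h
  fin_cases i
  exacts [absurd hi ha, absurd hi hb, hi]

/-- The cross product completes the pair to an orthogonal basis, in which only one member is
coloured. -/
theorem IsColoring.not_of_orthogonal (hc : IsColoring c) (a b : Fin 3 → ℤ)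
    (h : (a ≠ 0 ∧ b ≠ 0) ∧ crossProduct a b ≠ 0 ∧ a ⬝ᵥ b = 0) (ha : c a) : ¬c b := by
  intro hb
  obtain ⟨⟨ha0, hb0⟩, hd, hab⟩ := h
  obtain ⟨i, -, hi⟩ := hc.exists_of_triple a b (crossProduct a b)
    ⟨⟨ha0, hb0, hd⟩, hab, dot_self_cross a b, dot_cross_self a b⟩
  have h0 := hi 0 ha
  have h1 := hi 1 hb
  exact absurd (h0.trans h1.symm) (by decide)

/-- Colours propagate: a coloured vector excludes its orthogonal vectors, and two excluded members
of a basis force the third. Either branch ends with two orthogonal coloured vectors. -/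
theorem IsColoring.not_axis (hc : IsColoring c) : ¬c ![0, 0, 1] := by
  intro h001
  have hne := hc.not_of_orthogonal
  have hor := hc.third
  by_cases h01m1 : c ![0, 1, -1]
  · have h1m10 := hne ![0, 0, 1] ![1, -1, 0] (by decide) h001
    have h110 := hne ![0, 0, 1] ![1, 1, 0] (by decide) h001
    have h111 := hne ![0, 1, -1] ![1, 1, 1] (by decide) h01m1
    have h1m1m1 := hne ![0, 1, -1] ![1, -1, -1] (by decide) h01m1
    have h11m2 := hor ![1, -1, 0] ![1, 1, 1] ![1, 1, -2] (by decide) h1m10 h111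
    have h011 := hne ![0, 1, -1] ![0, 1, 1] (by decide) h01m1
    have h010 := hne ![0, 0, 1] ![0, 1, 0] (by decide) h001
    have h201 := hne ![1, 1, -2] ![2, 0, 1] (by decide) h11m2
    have h1m12 := hor ![1, -1, -1] ![1, 1, 0] ![1, -1, 2] (by decide) h1m1m1 h110
    have h10m2 := hor ![0, 1, 0] ![2, 0, 1] ![1, 0, -2] (by decide) h010 h201
    have h20m1 := hne ![1, -1, 2] ![2, 0, -1] (by decide) h1m12
    have h2m11 := hne ![1, 0, -2] ![2, -1, 1] (by decide) h10m2
    have h102 := hor ![0, 1, 0] ![2, 0, -1] ![1, 0, 2] (by decide) h010 h20m1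
    have h21m1 := hne ![1, 0, 2] ![2, 1, -1] (by decide) h102
    have h11m1 := hor ![0, 1, 1] ![2, -1, 1] ![1, 1, -1] (by decide) h011 h2m11
    have h101 := hne ![1, 1, -1] ![1, 0, 1] (by decide) h11m1
    have h10m1 := hor ![0, 1, 0] ![1, 0, 1] ![1, 0, -1] (by decide) h010 h101
    have h1m11 := hor ![0, 1, 1] ![2, 1, -1] ![1, -1, 1] (by decide) h011 h21m1
    exact hne ![1, -1, 1] ![1, 0, -1] (by decide) h1m11 h10m1
  -- Now `![0, 1, 1]` is forced to be coloured. Up to signs of vectors, the rest is the first case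
  -- reflected in the third coordinate.
  · have h110 := hne ![0, 0, 1] ![1, 1, 0] (by decide) h001
    have h1m10 := hne ![0, 0, 1] ![1, -1, 0] (by decide) h001
    have h100 := hne ![0, 0, 1] ![1, 0, 0] (by decide) h001
    have h010 := hne ![0, 0, 1] ![0, 1, 0] (by decide) h001
    have h011 := hor ![0, 1, -1] ![1, 0, 0] ![0, 1, 1] (by decide) h01m1 h100
    have h1m11 := hne ![0, 1, 1] ![1, -1, 1] (by decide) h011
    have h11m1 := hne ![0, 1, 1] ![1, 1, -1] (by decide) h011
    have h1m1m2 := hor ![1, -1, 1] ![1, 1, 0] ![1, -1, -2] (by decide) h1m11 h110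
    have h112 := hor ![1, -1, 0] ![1, 1, -1] ![1, 1, 2] (by decide) h1m10 h11m1
    have h20m1 := hne ![1, 1, 2] ![2, 0, -1] (by decide) h112
    have h201 := hne ![1, -1, -2] ![2, 0, 1] (by decide) h1m1m2
    have h102 := hor ![0, 1, 0] ![2, 0, -1] ![1, 0, 2] (by decide) h010 h20m1
    have h10m2 := hor ![0, 1, 0] ![2, 0, 1] ![1, 0, -2] (by decide) h010 h201
    have h2m1m1 := hne ![1, 0, 2] ![2, -1, -1] (by decide) h102
    have h211 := hne ![1, 0, -2] ![2, 1, 1] (by decide) h10m2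
    have h1m1m1 := hor ![0, 1, -1] ![2, 1, 1] ![1, -1, -1] (by decide) h01m1 h211
    have h111 := hor ![0, 1, -1] ![2, -1, -1] ![1, 1, 1] (by decide) h01m1 h2m1m1
    have h10m1 := hne ![1, 1, 1] ![1, 0, -1] (by decide) h111
    have h101 := hor ![0, 1, 0] ![1, 0, -1] ![1, 0, 1] (by decide) h010 h10m1
    exact hne ![1, -1, -1] ![1, 0, 1] (by decide) h1m1m1 h101

theorem IsColoring.comp_perm (hc : IsColoring c) (σ : Equiv.Perm (Fin 3)) :
    IsColoring fun v => c (v ∘ σ) := by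
  rintro v ⟨h0, h1⟩
  have hv : IsOrthogonalFrame fun i => v (σ i) ∘ σ := by
    refine ⟨fun i h => h0 (σ i) (funext fun k => ?_), fun i j hij => ?_⟩
    · simpa using congrFun h (σ.symm k)
    · rw [comp_equiv_dotProduct_comp_equiv]
      exact h1 _ _ fun h => hij (σ.injective h)
  obtain ⟨i, hi, hu⟩ := hc _ hv
  exact ⟨σ i, hi, fun j hj => by
    rw [← hu (σ.symm j) (by simpa using hj), Equiv.apply_symm_apply]⟩

/-- The Kochen-Specker theorem in dimension three. -/
theorem not_isColoring_three : ¬IsColoring c := by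
  intro hc
  have h0 : ![0, 0, 1] ∘ Equiv.swap (0 : Fin 3) 2 = (![1, 0, 0] : Fin 3 → ℤ) := by decide
  have h1 : ![0, 0, 1] ∘ Equiv.swap (1 : Fin 3) 2 = (![0, 1, 0] : Fin 3 → ℤ) := by decide
  refine hc.not_axis (hc.third ![1, 0, 0] ![0, 1, 0] ![0, 0, 1] (by decide) ?_ ?_)
  · exact h0 ▸ (hc.comp_perm (Equiv.swap 0 2)).not_axis
  · exact h1 ▸ (hc.comp_perm (Equiv.swap 1 2)).not_axis

end Three

/-- The Kochen-Specker theorem in dimension at least three. -/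
theorem not_isColoring {n : ℕ} (hn : 3 ≤ n) {c : (Fin n → ℤ) → Prop} : ¬IsColoring c := by
  intro hc
  have hstd : IsOrthogonalFrame fun i : Fin n => (Pi.single i 1 : Fin n → ℤ) :=
    ⟨fun i => by simp, fun i j hij => by simp [hij]⟩
  obtain ⟨i₀, hi₀, hu⟩ := hc _ hstd
  -- The three chosen coordinates include `i₀`, whose standard vector is coloured. Frames of the
  -- 3-space are completed by standard vectors outside it, none of which is coloured.
  obtain ⟨j, hj, k₀, hk₀⟩ : ∃ j : Fin 3 → Fin n, Function.Injective j ∧ ∃ k, j k = i₀ :=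
    ⟨Equiv.swap (Fin.castLE hn 0) i₀ ∘ Fin.castLE hn,
      (Equiv.injective _).comp (Fin.castLE_injective hn), 0, Equiv.swap_apply_left _ _⟩
  let ext (w : Fin 3 → ℤ) : Fin n → ℤ := Function.extend j w 0
  have hext (w : Fin 3 → ℤ) (k) : ext w (j k) = w k := hj.extend_apply _ _ _
  have hext' (w : Fin 3 → ℤ) (i) (hi : ¬∃ k, j k = i) : ext w i = 0 :=
    Function.extend_apply' _ _ _ hi
  have hdot (w w' : Fin 3 → ℤ) : ext w ⬝ᵥ ext w' = w ⬝ᵥ w' := by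
    simp only [dotProduct]
    rw [← Finset.sum_subset (Finset.subset_univ (Finset.univ.map ⟨j, hj⟩)), Finset.sum_map]
    · simp [hext]
    · intro i _ hi
      rw [hext' w i (by simpa using hi), zero_mul]
  refine not_isColoring_three (c := fun w => c (ext w)) ?_
  rintro v ⟨h0, h1⟩
  let v' : Fin n → Fin n → ℤ :=
    Function.extend j (fun k => ext (v k)) fun i => (Pi.single i 1 : Fin n → ℤ)
  have hv (k) : v' (j k) = ext (v k) := hj.extend_apply _ _ _
  have hv' (i) (hi : ¬∃ k, j k = i) : v' i = Pi.single i 1 := Function.extend_apply' _ _ _ hi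
  have hframe : IsOrthogonalFrame v' := by
    refine ⟨fun i h => ?_, fun i i' hii => ?_⟩
    · by_cases hik : ∃ k, j k = i
      · obtain ⟨k, rfl⟩ := hik
        refine h0 k (funext fun l => ?_)
        rw [← hext (v k) l, ← hv, h]
        rfl
      · rw [hv' i hik] at h
        exact hstd.1 i h
    · by_cases hik : ∃ k, j k = i <;> by_cases hik' : ∃ k, j k = i'
      · obtain ⟨k, rfl⟩ := hik
        obtain ⟨k', rfl⟩ := hik'
        rw [hv, hv, hdot]
        exact h1 _ _ fun h => hii (h ▸ rfl)
      · obtain ⟨k, rfl⟩ := hik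
        rw [hv, hv' i' hik', dotProduct_single_one, hext' _ _ hik']
      · obtain ⟨k', rfl⟩ := hik'
        rw [hv, hv' i hik, single_one_dotProduct, hext' _ _ hik]
      · rw [hv' i hik, hv' i' hik']
        exact hstd.2 _ _ hii
  obtain ⟨i, hi, hiu⟩ := hc v' hframe
  by_cases hik : ∃ k, j k = i
  · obtain ⟨k, rfl⟩ := hik
    refine ⟨k, by simpa only [hv] using hi, fun k' hk' => hj (hiu _ ?_)⟩
    simpa only [hv] using hk'
  · rw [hv' i hik] at hi
    exact absurd ⟨k₀, hk₀.trans (hu i hi).symm⟩ hik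

/-- A compactness principle: if the family `N` of inconsistent finite sets does not contain the
empty set, there is a consistent set that meets every member of `B`. -/
theorem exists_consistent {V ι : Type*} [Finite ι] [DecidableEq V] (N : Finset V → Prop)
    (B : Set (ι → V)) (h0 : ¬N ∅) (hmono : ∀ s t, s ⊆ t → N s → N t)
    (hB : ∀ b ∈ B, ∀ s, (∀ i, N (insert (b i) s)) → N s) :
    ∃ F : Set V, (∀ s : Finset V, ↑s ⊆ F → ¬N s) ∧ ∀ b ∈ B, ∃ i, b i ∈ F := by
  obtain ⟨F, hF⟩ := zorn_subset {F : Set V | ∀ s : Finset V, ↑s ⊆ F → ¬N s} (by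
    intro C hC hch
    rcases C.eq_empty_or_nonempty with rfl | hne
    · refine ⟨∅, fun s hs => ?_, by simp⟩
      rw [Set.subset_empty_iff, Finset.coe_eq_empty] at hs
      rwa [hs]
    · refine ⟨⋃₀ C, fun s hs => ?_, fun F hF => Set.subset_sUnion_of_mem hF⟩
      obtain ⟨F, hF, hsF⟩ := DirectedOn.exists_mem_subset_of_finset_subset_biUnion hne
        hch.directedOn (f := id) (s := s) (by simpa [Set.sUnion_eq_biUnion] using hs)
      exact hC hF s hsF)
  refine ⟨F, hF.prop, fun b hb => ?_⟩
  by_contra! hbF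
  have (i : ι) : ∃ s : Finset V, ↑s ⊆ F ∧ N (insert (b i) s) := by
    by_contra! h
    refine hbF i (hF.le_of_ge (y := insert (b i) F) (fun s hs hN => ?_)
      (Set.subset_insert _ _) (Set.mem_insert _ _))
    refine h (s.erase (b i)) (fun x hx => ?_) (hmono s _ (Finset.insert_erase_subset _ _) hN)
    rw [Finset.coe_erase] at hx
    exact (hs hx.1).resolve_left hx.2
  -- By maximality each `b i` is inconsistent with a finite `s i` inside `F`. As `ι` is finite, the
  -- union of the `s i` is a finite subset of `F`, inconsistent with every `b i` and hence
  -- inconsistent by itself.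
  choose s hsF hsN using this
  have := Fintype.ofFinite ι
  refine hF.prop (Finset.univ.biUnion s) (by simpa using hsF) (hB b hb _ fun i => ?_)
  exact hmono _ _ (Finset.insert_subset_insert _ (Finset.subset_biUnion_of_mem s (by simp))) (hsN i)

end KochenSpecker

/-! ### Projections of a C*-algebra as subterminal objects -/

namespace CStarAlg

/-- The open set of characters that do not vanish at `a`. -/
def basicOpen (A : commutative.{u}.FullSubcategory) (a : A.obj) :
    (gelfandSpectrum.obj (op A) : Locale.{u}) :=
  (⟨{χ | χ a ≠ 0}, isOpen_ne.preimage (map_continuous (WeakDual.gelfandTransform ℂ A.obj a))⟩ :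
    TopologicalSpace.Opens (WeakDual.characterSpace ℂ A.obj))

theorem basicOpen_inf_eq_bot (A : commutative.{u}.FullSubcategory) {a b : A.obj}
    (h : a * b = 0) : basicOpen A a ⊓ basicOpen A b = ⊥ := by
  refine TopologicalSpace.Opens.ext (Set.eq_empty_iff_forall_notMem.2 ?_)
  rintro χ ⟨ha, hb⟩
  exact mul_ne_zero ha hb (by rw [← map_mul, h, map_zero])

theorem iSup_basicOpen_eq_top (A : commutative.{u}.FullSubcategory) {ι : Type*} [Fintype ι]
    {a : ι → A.obj} (h : ∑ i, a i = 1) : ⨆ i, basicOpen A (a i) = ⊤ := by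
  refine TopologicalSpace.Opens.ext (Set.eq_univ_of_forall fun χ => ?_)
  obtain ⟨i, -, hi⟩ : ∃ i ∈ Finset.univ, χ (a i) ≠ 0 := by
    refine Finset.exists_ne_zero_of_sum_ne_zero ?_
    rw [← map_sum, h, map_one]
    exact one_ne_zero
  exact TopologicalSpace.Opens.mem_iSup.2 ⟨i, hi⟩

section Spectrum

variable {G : CStarAlg.{u}ᵒᵖ ⥤ Topos.{u}}
  (α : commutative.{u}.ι.op ⋙ G ≅ gelfandSpectrum.{u} ⋙ Locale.shFunctor.{u})

/-- The geometric morphism to the spectrum of a commutative C*-algebra `A` that is induced by a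
*-homomorphism out of `A`. -/
def toSpectrum {A : commutative.{u}.FullSubcategory} {M : CStarAlg.{u}} (φ : A.obj ⟶ M) :
    GeometricMorphism (G.obj (op M)) (Locale.Sh (gelfandSpectrum.obj (op A))) :=
  Quotient.out (s := GeometricMorphism.setoid _ _)
    (show _root_.Quotient (GeometricMorphism.setoid (G.obj (op M)) _) from
      G.map φ.op ≫ α.hom.app (op A))

/-- The inverse image of the open set where `a` does not vanish. -/
def support {A : commutative.{u}.FullSubcategory} {M : CStarAlg.{u}} (φ : A.obj ⟶ M)
    (a : A.obj) : G.obj (op M) :=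
  (toSpectrum α φ).inverse.obj ((Locale.topology _).yoneda.obj (basicOpen A a))

/-- Naturality of `α` at `h` is an equality of isomorphism classes, so the chosen representatives
have isomorphic inverse images. -/
theorem nonempty_iso_toSpectrum_comp {A B : commutative.{u}.FullSubcategory} {M : CStarAlg.{u}}
    (h : A ⟶ B) (φ : B.obj ⟶ M) :
    Nonempty ((toSpectrum α (h.hom ≫ φ)).inverse ≅
      (Locale.shMap (gelfandSpectrum.map h.op).unop.hom).inverse ⋙
        (toSpectrum α φ).inverse) := by
  have hnat : G.map (h.hom ≫ φ).op ≫ α.hom.app (op A) =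
      (G.map φ.op ≫ α.hom.app (op B)) ≫ Locale.shFunctor.map (gelfandSpectrum.map h.op) := by
    have := α.hom.naturality h.op
    rw [op_comp, G.map_comp, Category.assoc, Category.assoc]
    exact congrArg _ this
  refine Quotient.exact (s := GeometricMorphism.setoid _ _) (a := toSpectrum α (h.hom ≫ φ))
    (b := (toSpectrum α φ).comp (Locale.shMap (gelfandSpectrum.map h.op).unop.hom)) ?_
  refine (Quotient.out_eq _).trans (hnat.trans ?_)
  conv_lhs => rw [← Quotient.out_eq (G.map φ.op ≫ α.hom.app (op B))]
  rfl

theorem nonempty_support_comp_hom {A B : commutative.{u}.FullSubcategory} {M : CStarAlg.{u}}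
    (h : A ⟶ B) (φ : B.obj ⟶ M) (a : A.obj) :
    Nonempty (support α (h.hom ≫ φ) a ⟶ support α φ (h.hom.hom a)) := by
  obtain ⟨e⟩ := nonempty_iso_toSpectrum_comp α h φ
  obtain ⟨f⟩ := Locale.nonempty_shMap_inverse_hom (gelfandSpectrum.map h.op).unop.hom
    (basicOpen A a)
  exact ⟨e.hom.app _ ≫ (toSpectrum α φ).inverse.map f⟩

theorem nonempty_hom_support_comp {A B : commutative.{u}.FullSubcategory} {M : CStarAlg.{u}}
    (h : A ⟶ B) (φ : B.obj ⟶ M) (a : A.obj) :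
    Nonempty (support α φ (h.hom.hom a) ⟶ support α (h.hom ≫ φ) a) := by
  obtain ⟨e⟩ := nonempty_iso_toSpectrum_comp α h φ
  obtain ⟨f⟩ := Locale.nonempty_hom_shMap_inverse (gelfandSpectrum.map h.op).unop.hom
    (basicOpen A a)
  exact ⟨(toSpectrum α φ).inverse.map f ≫ e.inv.app _⟩

end Spectrum

/-! ### Finite-dimensional commutative C*-algebras -/

/-- The commutative C*-algebra of complex functions on a finite set. -/
def functions (ι : Type u) [Fintype ι] : commutative.{u}.FullSubcategory :=
  ⟨⟨ι → ℂ⟩, fun a b => mul_comm (G := ι → ℂ) a b⟩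

/-- Precomposition with a map of finite sets. -/
def functionsMap {ι κ : Type u} [Fintype ι] [Fintype κ] (g : ι → κ) :
    functions κ ⟶ functions ι :=
  ObjectProperty.homMk
    ⟨{ toFun := fun f : κ → ℂ => (f ∘ g : ι → ℂ)
       map_one' := rfl
       map_mul' := fun _ _ => rfl
       map_zero' := rfl
       map_add' := fun _ _ => rfl
       commutes' := fun _ => rfl
       map_star' := fun _ => rfl }⟩

/-- The *-homomorphism out of the functions on a finite set that is given by a complete family of
orthogonal projections. -/
def ofProjections {ι : Type u} [Fintype ι] {M : CStarAlg.{u}} (p : ι → M)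
    (hp : CompleteOrthogonalIdempotents p) (hs : ∀ i, IsSelfAdjoint (p i)) :
    (functions ι).obj ⟶ M :=
  ⟨{ toFun := fun f : ι → ℂ => ∑ i, f i • p i
     map_one' := by
       change ∑ i, (1 : ℂ) • p i = 1
       simp [hp.complete]
     map_mul' := fun f g => by
       classical
       change ∑ i, (f i * g i) • p i = (∑ i, f i • p i) * ∑ i, g i • p i
       rw [Finset.sum_mul_sum]
       refine Finset.sum_congr rfl fun i _ => ?_
       rw [Finset.sum_eq_single i]
       · rw [smul_mul_smul_comm, hp.idem i]
       · intro j _ hj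
         rw [smul_mul_smul_comm, hp.ortho hj.symm, smul_zero]
       · simp
     map_zero' := by
       change ∑ i, (0 : ℂ) • p i = 0
       simp
     map_add' := fun f g => by
       change ∑ i, (f i + g i) • p i = _
       simp [add_smul, Finset.sum_add_distrib]
     commutes' := fun r => by
       change ∑ i, r • p i = _
       rw [← Finset.smul_sum, hp.complete, Algebra.algebraMap_eq_smul_one]
     map_star' := fun f => by
       change ∑ i, star (f i) • p i = star (∑ i, f i • p i)
       simp [star_sum, star_smul, fun i => (hs i).star_eq] }⟩

theorem isSelfAdjoint_cond {M : CStarAlg.{u}} {p : M} (hp : IsStarProjection p)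
    (b : ULift.{u} Bool) : IsSelfAdjoint (cond b.down p (1 - p)) := by
  rcases b with ⟨_ | _⟩
  exacts [hp.one_sub.isSelfAdjoint, hp.isSelfAdjoint]

theorem completeOrthogonalIdempotents_cond {M : CStarAlg.{u}} {p : M} (hp : IsStarProjection p) :
    CompleteOrthogonalIdempotents fun b : ULift.{u} Bool => cond b.down p (1 - p) where
  idem := by
    rintro ⟨_ | _⟩
    exacts [hp.one_sub.isIdempotentElem, hp.isIdempotentElem]
  ortho := by
    have h := hp.isIdempotentElem.eq
    rintro ⟨_ | _⟩ ⟨_ | _⟩ hij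
    · exact absurd rfl hij
    · simp [sub_mul, h]
    · simp [mul_sub, h]
    · exact absurd rfl hij
  complete := by
    rw [← Equiv.ulift.symm.sum_comp]
    simp

/-- The *-homomorphism out of `ℂ²` given by a projection. -/
def ofProjection {M : CStarAlg.{u}} (p : {p : M // IsStarProjection p}) :
    (functions (ULift.{u} Bool)).obj ⟶ M :=
  ofProjections _ (completeOrthogonalIdempotents_cond p.2) (isSelfAdjoint_cond p.2)

/-- Pulling back along the indicator of `i` merges the other projections into their sum, which is `1
- p i`. -/
theorem ofProjection_eq {ι : Type u} [Fintype ι] [DecidableEq ι] {M : CStarAlg.{u}}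
    (p : ι → {p : M // IsStarProjection p})
    (hp : CompleteOrthogonalIdempotents fun i => (p i : M)) (i : ι) :
    ofProjection (p i) =
      (functionsMap fun j => ULift.up (decide (j = i))).hom ≫
        ofProjections _ hp fun i => (p i).2.isSelfAdjoint := by
  refine CStarAlg.Hom.ext (StarAlgHom.ext fun f => ?_)
  change ∑ b : ULift Bool, f b • cond b.down (p i : M) (1 - p i) =
    ∑ j, f (ULift.up (decide (j = i))) • (p j : M)
  rw [← Equiv.ulift.symm.sum_comp, ← Finset.add_sum_erase _ _ (Finset.mem_univ i),
    ← hp.complete, ← Finset.add_sum_erase _ (fun i => (p i : M)) (Finset.mem_univ i),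
    add_sub_cancel_left]
  simp only [Fintype.sum_bool, decide_true, Equiv.ulift_symm_apply, cond_true, cond_false]
  rw [Finset.smul_sum]
  congr 1
  refine Finset.sum_congr rfl fun j hj => ?_
  rw [decide_eq_false (Finset.ne_of_mem_erase hj)]

section Projections

variable {G : CStarAlg.{u}ᵒᵖ ⥤ Topos.{u}}
  (α : commutative.{u}.ι.op ⋙ G ≅ gelfandSpectrum.{u} ⋙ Locale.shFunctor.{u})
  {M : CStarAlg.{u}}

/-- The subterminal object associated with a projection. -/
def supportProj (p : {p : M // IsStarProjection p}) : G.obj (op M) :=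
  support α (ofProjection p) (fun b : ULift.{u} Bool => cond b.down 1 0 : ULift.{u} Bool → ℂ)

variable {ι : Type u} [Fintype ι] (p : ι → {p : M // IsStarProjection p})
    (hp : CompleteOrthogonalIdempotents fun i => (p i : M))

/-- Non-contextuality: the support of `p i` computed in any complete family agrees with the one
computed from `p i` alone. -/
theorem nonempty_supportProj_hom_and [DecidableEq ι] (i : ι) :
    Nonempty (supportProj α (p i) ⟶ support α
      (ofProjections _ hp fun i => (p i).2.isSelfAdjoint) (Pi.single i 1 : ι → ℂ)) ∧
    Nonempty (support α (ofProjections _ hp fun i => (p i).2.isSelfAdjoint)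
      (Pi.single i 1 : ι → ℂ) ⟶ supportProj α (p i)) := by
  have h : (functionsMap fun j => ULift.up (decide (j = i))).hom.hom
      (fun b : ULift.{u} Bool => cond b.down 1 0 : ULift.{u} Bool → ℂ) =
      (Pi.single i 1 : ι → ℂ) := by
    funext j
    change cond (decide (j = i)) (1 : ℂ) 0 = _
    by_cases hj : j = i
    · subst hj; simp
    · simp [hj]
  rw [supportProj, ofProjection_eq p hp i, ← h]
  exact ⟨nonempty_support_comp_hom α _ _ _, nonempty_hom_support_comp α _ _ _⟩

include hp

theorem isInitial_of_hom_supportProj {i j : ι} (hij : i ≠ j) {W : G.obj (op M)}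
    (a : W ⟶ supportProj α (p i)) (b : W ⟶ supportProj α (p j)) : Nonempty (IsInitial W) := by
  classical
  obtain ⟨⟨a'⟩, -⟩ := nonempty_supportProj_hom_and α p hp i
  obtain ⟨⟨b'⟩, -⟩ := nonempty_supportProj_hom_and α p hp j
  refine Locale.isInitial_of_inf_eq_bot _ (basicOpen_inf_eq_bot _ ?_) (a ≫ a') (b ≫ b')
  funext k
  change (Pi.single i 1 : ι → ℂ) k * (Pi.single j 1 : ι → ℂ) k = 0
  by_cases hk : k = i
  · rw [Pi.single_eq_of_ne (hk ▸ hij : k ≠ j), mul_zero]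
  · rw [Pi.single_eq_of_ne hk, zero_mul]

theorem isInitial_of_forall_supportProj {W : G.obj (op M)}
    (h : ∀ (i : ι) (W' : G.obj (op M)), (W' ⟶ W) → (W' ⟶ supportProj α (p i)) →
      Nonempty (IsInitial W')) : Nonempty (IsInitial W) := by
  classical
  refine Locale.isInitial_of_iSup_eq_top
    (toSpectrum α (ofProjections _ hp fun i => (p i).2.isSelfAdjoint))
    (iSup_basicOpen_eq_top (functions ι) (a := fun i => (Pi.single i 1 : ι → ℂ)) ?_)
    fun i W' f g => ?_
  · exact Finset.univ_sum_single (1 : ι → ℂ)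
  · obtain ⟨-, ⟨b⟩⟩ := nonempty_supportProj_hom_and α p hp i
    exact h i W' f (g ≫ b)

end Projections

end CStarAlg

/-! ### Projections onto integer vectors -/

namespace KochenSpecker

variable {ι : Type*} [Fintype ι]

/-- The matrix of the orthogonal projection onto the line through an integer vector. -/
def projection (v : ι → ℤ) : Matrix ι ι ℂ :=
  ((v ⬝ᵥ v : ℤ) : ℂ)⁻¹ • Matrix.vecMulVec (fun i => (v i : ℂ)) fun i => (v i : ℂ)

theorem projection_mul_projection (v w : ι → ℤ) : projection v * projection w =
    ((v ⬝ᵥ v : ℤ) : ℂ)⁻¹ • ((w ⬝ᵥ w : ℤ) : ℂ)⁻¹ • ((v ⬝ᵥ w : ℤ) : ℂ) •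
      Matrix.vecMulVec (fun i => (v i : ℂ)) fun i => (w i : ℂ) := by
  have h : ((v ⬝ᵥ w : ℤ) : ℂ) = (fun i => (v i : ℂ)) ⬝ᵥ fun i => (w i : ℂ) := by
    simp [dotProduct]
  rw [projection, projection, Matrix.smul_mul, Matrix.mul_smul, Matrix.vecMulVec_mul_vecMulVec, h,
    Matrix.vecMulVec_smul]

theorem isStarProjection_projection (v : ι → ℤ) : IsStarProjection (projection v) where
  isIdempotentElem := by
    rw [IsIdempotentElem, projection_mul_projection, projection]
    -- For `v = 0` the inverse is `0` by convention and the projection is `0`, so no hypothesis on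
    -- `v` is needed.
    by_cases h : ((v ⬝ᵥ v : ℤ) : ℂ) = 0
    · simp [h]
    · rw [inv_smul_smul₀ h]
  isSelfAdjoint := by
    ext i j
    simp [projection, Matrix.vecMulVec_apply, mul_comm]

theorem IsOrthogonalFrame.completeOrthogonalIdempotents [DecidableEq ι] {v : ι → ι → ℤ}
    (hv : IsOrthogonalFrame v) : CompleteOrthogonalIdempotents fun i => projection (v i) where
  idem i := (isStarProjection_projection (v i)).isIdempotentElem
  ortho i j hij := by
    change projection (v i) * projection (v j) = 0
    rw [projection_mul_projection, hv.2 i j hij]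
    simp
  complete := by
    -- `A` has rows `v i`, and `B` is its transpose with rescaled columns. Orthogonality says `A * B
    -- = 1`; the sum of the projections is `B * A`.
    let A : Matrix ι ι ℂ := .of fun i k => (v i k : ℂ)
    let B : Matrix ι ι ℂ := .of fun k i => ((v i ⬝ᵥ v i : ℤ) : ℂ)⁻¹ * v i k
    have hAB : A * B = 1 := by
      ext i j
      have h : (A * B) i j = ((v j ⬝ᵥ v j : ℤ) : ℂ)⁻¹ * ((v i ⬝ᵥ v j : ℤ) : ℂ) := by
        simp only [Matrix.mul_apply, A, B, Matrix.of_apply, dotProduct, Int.cast_sum,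
          Int.cast_mul, Finset.mul_sum]
        exact Finset.sum_congr rfl fun k _ => by ring
      rw [h]
      by_cases hij : i = j
      · subst hij
        rw [Matrix.one_apply_eq, inv_mul_cancel₀]
        exact_mod_cast fun h0 => hv.1 i (dotProduct_self_eq_zero.1 h0)
      · rw [hv.2 i j hij, Matrix.one_apply_ne hij, Int.cast_zero, mul_zero]
    rw [← mul_eq_one_comm.1 hAB]
    ext k l
    simp only [Matrix.sum_apply, projection, Matrix.smul_apply, Matrix.vecMulVec_apply, smul_eq_mul,
      Matrix.mul_apply, A, B, Matrix.of_apply, mul_assoc]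

end KochenSpecker

theorem CStarAlg.isInitial_of_equiv_matrix {G : CStarAlg.{u}ᵒᵖ ⥤ Topos.{u}}
    (α : commutative.{u}.ι.op ⋙ G ≅ gelfandSpectrum.{u} ⋙ Locale.shFunctor.{u})
    {n : ℕ} (hn : 3 ≤ n) {M : CStarAlg.{u}} (e : M ≃⋆ₐ[ℂ] Matrix (Fin n) (Fin n) ℂ)
    (W₀ : G.obj (op M)) : Nonempty (IsInitial W₀) := by
  classical
  by_contra hW₀
  let P (v : Fin n → ℤ) : {p : M // IsStarProjection p} :=
    ⟨e.symm (KochenSpecker.projection v),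
      (KochenSpecker.isStarProjection_projection v).map e.symm⟩
  have hP {v : Fin n → Fin n → ℤ} (hv : KochenSpecker.IsOrthogonalFrame v) :
      CompleteOrthogonalIdempotents fun i : ULift.{u} (Fin n) => (P (v i.down) : M) :=
    (CompleteOrthogonalIdempotents.equiv Equiv.ulift).2
      (hv.completeOrthogonalIdempotents.map (e.symm : Matrix (Fin n) (Fin n) ℂ →+* M))
  -- `N s` says that the supports of the vectors in `s` have empty intersection in `G(M)`.
  let N (s : Finset (Fin n → ℤ)) : Prop := ∀ W : G.obj (op M),
    (∀ v ∈ s, Nonempty (W ⟶ supportProj α (P v))) → Nonempty (IsInitial W)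
  obtain ⟨F, hF, hFB⟩ := KochenSpecker.exists_consistent N
    {v : Fin n → Fin n → ℤ | KochenSpecker.IsOrthogonalFrame v}
    (fun h => hW₀ (h W₀ (by simp))) (fun s t hst hs W hW => hs W fun v hv => hW v (hst hv)) (by
      intro v hv s hs W hW
      refine isInitial_of_forall_supportProj α _ (hP hv) fun i W' f g => hs i.down W' ?_
      intro w hw
      rcases Finset.mem_insert.1 hw with rfl | hw
      exacts [⟨g⟩, (hW w hw).map (f ≫ ·)])
  refine KochenSpecker.not_isColoring hn (c := (· ∈ F)) fun v hv => ?_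
  obtain ⟨i, hi⟩ := hFB v hv
  refine ⟨i, hi, fun j hj => ?_⟩
  by_contra hij
  -- Two members of one frame have disjoint supports, so they cannot both lie in the consistent set
  -- `F`.
  refine hF {v i, v j} (by simp [Set.insert_subset_iff, hi, hj]) fun W hW => ?_
  obtain ⟨a⟩ := hW (v i) (by simp)
  obtain ⟨b⟩ := hW (v j) (by simp)
  exact isInitial_of_hom_supportProj α (fun k : ULift.{u} (Fin n) => P (v k.down)) (hP hv)
    (i := ⟨i⟩) (j := ⟨j⟩) (fun h => hij (congrArg ULift.down h).symm) a b

end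

theorem mainTheorem4
    (G : CStarAlg.{u}ᵒᵖ ⥤ Topos.{u})
    (hG : Nonempty
      (CStarAlg.commutative.{u}.ι.op ⋙ G ≅ CStarAlg.gelfandSpectrum.{u} ⋙ Locale.shFunctor.{u}))
    (n : ℕ) (hn : 3 ≤ n)
    (M : CStarAlg.{u}) (hM : Nonempty (M ≃⋆ₐ[ℂ] Matrix (Fin n) (Fin n) ℂ)) :
    Nonempty (IsInitial (G.obj (op M))) ∧ Nonempty (G.obj (op M) ≌ Discrete PUnit.{u + 1}) := by
  obtain ⟨α⟩ := hG
  obtain ⟨e⟩ := hM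
  have h := CStarAlg.isInitial_of_equiv_matrix α hn e
  have := IsTopos.hasFiniteLimits (E := G.obj (op M))
  exact ⟨Topos.nonempty_isInitial _ h, IsTopos.nonempty_equivalence_punit (⊤_ _) h⟩
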